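/- Let $d\ge 2$ and let $\mathcal A$ be the set of all vectors $a=(\alpha_1,\dots,\alpha_d)$ with $\alpha_i>0$ for every $i$ and $2\sum_{i=1}^d\alpha_i=1$. For $a\in\mathcal A$ let $\mathbf S_t=\mathbf S_t(a,d)$, $t=0,1,2,\dots$, be the symmetric random walk in $\mathbb Z^d$ with parameter $a$: $\mathbf S_0=\mathbf 0$ and $\mathbf S_t=\mathbf S_{t-1}+\mathbf e_t$ for $t\ge1$, where $\mathbf e_1,\mathbf e_2,\dots$ are independent and each $\mathbf e_t$ takes each of the values $\mathbf 1_i$ and $-\mathbf 1_i$ with probability $\alpha_i$, $i=1,\dots,d$ (here $\mathbf 1_i$ is the $i$th standard unit vector). Write $\|\mathbf n\|=\sum_{i=1}^d|n^{(i)}|$ for $\mathbf n\in\mathbb Z^d$, and let $t_0=0$ and $t_{j+1}=\inf\{t>t_j:\|\mathbf S_t\|\ne\|\mathbf S_{t_j}\|\}$ for $j\ge0$ (so $t_j=j$ almost surely). For $n\ge0$ put $$p^{(a,d)}(n)=\lim_{j\to\infty}\mathsf P\big\{\|\mathbf S_{t_{j+1}}(a,d)\|=n+1\ \big|\ \|\mathbf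 S_{t_j}(a,d)\|=n\big\},$$ where $j$ runs through the indices for which the conditioning event has positive probability. For $\gamma>0$ let $BD(\gamma,d)$ be the birth-and-death process whose birth rates $\lambda_n(\gamma,d)$ and death rates $\mu_n(\gamma,d)$ are, for $n\ge1$, $$\lambda_n(\gamma,d)=\sum_{i=1}^d i\gamma^i\binom di\binom{n-1}{i-1}+\gamma\sum_{i=1}^{d-1}(d-i)\gamma^i\binom di\binom{n-1}{i-1},\qquad \mu_n(\gamma,d)=\sum_{i=1}^d i\gamma^i\binom di\binom{n-1}{i-1},$$ with $\mu_0(\gamma,d)=0$ and $\lambda_0(\gamma,d)>0$ arbitrary. Then for every $n\ge0$ and every $a\in\mathcal A$ there are infinitely many such indices $j$ and the limit $p^{(a,d)}(n)$ exists. The family of symmetric random walks is conservative, that is, $p^{(a_1,d)}(n)=p^{(a_2,d)}(n)$ for all $a_1,a_2\in\mathcal A$ and all $n\ge0$. Specifically, for all $a\in\mathcal A$ and all $n\ge0$, $$p^{(a,d)}(n)=\frac{\lambda_n(2,d)}{\lambda_n(2,d)+\mu_n(2,d)},$$ the birth probability in state $n$ of $BD(2,d)$. -/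

import Mathlib

open MeasureTheory ProbabilityTheory Filter Topology

noncomputable section

/-- The norm `|n⁽¹⁾| + ⋯ + |n⁽ᵈ⁾|` of a vector of `ℤᵈ`. -/
def l1Norm {d : ℕ} (x : Fin d → ℤ) : ℕ := ∑ i, (x i).natAbs

/-- The parameters `(α₁, …, α_d)` with all `α_i > 0` and `2 (α₁ + ⋯ + α_d) = 1`. -/
def symmetricParams (d : ℕ) : Set (Fin d → ℝ) :=
  {α | (∀ i, 0 < α i) ∧ 2 * ∑ i, α i = 1}

/-- `S` is the symmetric random walk in `ℤᵈ` with parameter `α`: it starts at the origin, its steps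
are independent, and each step equals `1_i` with probability `α i` and `-1_i` with probability
`α i`. -/
structure IsSymmetricWalk {d : ℕ} {Ω : Type*} [MeasurableSpace Ω] (P : Measure Ω)
    (α : Fin d → ℝ) (S : ℕ → Ω → Fin d → ℤ) : Prop where
  measurable : ∀ t, Measurable (S t)
  start : ∀ ω, S 0 ω = 0
  indep : iIndepFun (fun t ω => S (t + 1) ω - S t ω) P
  step_pos : ∀ t i, P.real {ω | S (t + 1) ω - S t ω = Pi.single i 1} = α i
  step_neg : ∀ t i, P.real {ω | S (t + 1) ω - S t ω = -Pi.single i 1} = α i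

/-- The active time instants of a path `s`: `t_0 = 0`, and `t_{j+1}` is the first time after `t_j`
at which the norm differs from the norm at time `t_j`. (If there is no such time, which for a
symmetric random walk has probability zero, the value is `0`.) -/
def activeTime {d : ℕ} (s : ℕ → Fin d → ℤ) : ℕ → ℕ
  | 0 => 0
  | j + 1 => sInf {t | activeTime s j < t ∧ l1Norm (s t) ≠ l1Norm (s (activeTime s j))}

/-- The norm of the walk at its `j`-th active time instant. -/
def activeNorm {d : ℕ} {Ω : Type*} (S : ℕ → Ω → Fin d → ℤ) (j : ℕ) (ω : Ω) : ℕ :=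
  l1Norm (S (activeTime (fun t => S t ω) j) ω)

/-- The conditional probability that the norm is `n + 1` at active time `t_{j+1}`, given that it is
`n` at active time `t_j`. -/
def upProb {d : ℕ} {Ω : Type*} [MeasurableSpace Ω] (P : Measure Ω) (S : ℕ → Ω → Fin d → ℤ)
    (j n : ℕ) : ℝ :=
  (cond P {ω | activeNorm S j ω = n}).real {ω | activeNorm S (j + 1) ω = n + 1}

/-- The `j` for which the conditional probability `upProb P S j n` is meaningful, that is, for which
its conditioning event has positive probability. -/
def admissible {d : ℕ} {Ω : Type*} [MeasurableSpace Ω] (P : Measure Ω) (S : ℕ → Ω → Fin d → ℤ)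
    (n : ℕ) : Set ℕ :=
  {j | P {ω | activeNorm S j ω = n} ≠ 0}

/-- The limiting probability `p(n)` of a move from level `n` to level `n + 1` exists and equals `p`:
infinitely many of the conditional probabilities are meaningful, and those tend to `p` as
`j → ∞`. -/
def IsLimitingUpProb {d : ℕ} {Ω : Type*} [MeasurableSpace Ω] (P : Measure Ω)
    (S : ℕ → Ω → Fin d → ℤ) (n : ℕ) (p : ℝ) : Prop :=
  (admissible P S n).Infinite ∧
    Tendsto (fun j => upProb P S j n) (atTop ⊓ 𝓟 (admissible P S n)) (𝓝 p)

/-- A family of random walks indexed by the parameters `a : A` is conservative if for all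
parameters `a₁`, `a₂` and all `n ≥ 0` the limiting probabilities of a move from level `n` to level
`n + 1` exist and are equal. -/
def IsConservative {d : ℕ} {A : Type*} {Ω : A → Type*} [∀ a, MeasurableSpace (Ω a)]
    (P : ∀ a, Measure (Ω a)) (S : ∀ a, ℕ → Ω a → Fin d → ℤ) : Prop :=
  ∀ a₁ a₂ : A, ∀ n : ℕ, ∃ p : ℝ,
    IsLimitingUpProb (P a₁) (S a₁) n p ∧ IsLimitingUpProb (P a₂) (S a₂) n p

/-- The birth rates `λ_n(γ, d)` of the birth-and-death process `BD(γ, d)`; the rate `λ_0` is a free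
parameter. -/
def bdBirth (lam0 γ : ℝ) (d n : ℕ) : ℝ :=
  if n = 0 then lam0 else
    ∑ i ∈ Finset.Icc 1 d, (i : ℝ) * γ ^ i * (d.choose i : ℝ) * ((n - 1).choose (i - 1) : ℝ) +
      γ * ∑ i ∈ Finset.Icc 1 (d - 1),
        ((d : ℝ) - i) * γ ^ i * (d.choose i : ℝ) * ((n - 1).choose (i - 1) : ℝ)

/-- The death rates `μ_n(γ, d)` of the birth-and-death process `BD(γ, d)`; there are no deaths in
state `0`. -/
def bdDeath (γ : ℝ) (d n : ℕ) : ℝ :=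
  if n = 0 then 0 else
    ∑ i ∈ Finset.Icc 1 d, (i : ℝ) * γ ^ i * (d.choose i : ℝ) * ((n - 1).choose (i - 1) : ℝ)

end

/-! Let `w` be the step law in the group algebra, so that P(S_t = x) is the coefficient of `w ^ t`
at `x`. Almost surely every step changes the norm by one, hence t_j = j, and `upProb` is the average
over the sphere of radius n of the one-step upward probabilities `upWeight`, weighted by the
coefficients of `w ^ j`.

These weights become uniform by a ratio limit theorem (`tendsto_stepLaw_ratio`), for which no local
limit theorem is needed. Cauchy–Schwarz and symmetry make the return probabilities r_m = `w ^ (2 *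
m)` at 0 maximal and log-convex; since supports grow polynomially, r_{m+1}/r_m → 1. As r_{m+k} is an
average of values of `w ^ (2 * m)`, none above r_m, every value that has positive weight must be
asymptotic to r_m.

With N_d(n) the size of the sphere, the uniform average of `upWeight` is (N_d + N_{d-1})/(2 N_d):
for each i, exactly N_{d-1} points have x_i = 0, so the parameter enters only through its sum 1/2
(`sum_upWeight`). For n ≥ 1 the rates are d(N_d + N_{d-1}) and d(N_d - N_{d-1}), with the same
quotient. -/

noncomputable section

/-! ### Ratio limits for symmetric probabilities on an abelian group -/

/-- A positive decreasing log-convex sequence that does not decay faster than polynomially has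
ratios tending to `1`. -/
lemma tendsto_ratio_one_of_logConvex {a : ℕ → ℝ} (hpos : ∀ n, 0 < a n)
    (hanti : ∀ n, a (n + 1) ≤ a n) (hconv : ∀ n, a (n + 1) ^ 2 ≤ a n * a (n + 2))
    {C d : ℕ} (hpoly : ∀ n : ℕ, 1 ≤ a n * ((C : ℝ) * n + 1) ^ d) :
    Tendsto (fun n => a (n + 1) / a n) atTop (𝓝 1) := by
  have hmono : Monotone fun n => a (n + 1) / a n := by
    refine monotone_nat_of_le_succ fun n => ?_
    rw [div_le_div_iff₀ (hpos _) (hpos _)]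
    have := hconv n
    nlinarith
  have hle : ∀ n, a (n + 1) / a n ≤ 1 := fun n => (div_le_one (hpos n)).2 (hanti n)
  have hbdd : BddAbove (Set.range fun n => a (n + 1) / a n) :=
    ⟨1, by rintro _ ⟨n, rfl⟩; exact hle n⟩
  have hlim := tendsto_atTop_ciSup hmono hbdd
  set R := ⨆ n, a (n + 1) / a n with hR
  have hRle : R ≤ 1 := ciSup_le hle
  have hRpos : 0 < R := lt_of_lt_of_le (div_pos (hpos 1) (hpos 0)) (le_ciSup hbdd 0)
  suffices h : R = 1 by rwa [h] at hlim
  -- A limit R < 1 would force geometric decay, against the polynomial lower bound.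
  refine le_antisymm hRle (not_lt.1 fun hlt => ?_)
  have hgeo : ∀ n, a n ≤ a 0 * R ^ n := by
    intro n
    induction n with
    | zero => simp
    | succ n ih =>
      have h1 : a (n + 1) ≤ R * a n := (div_le_iff₀ (hpos n)).1 (le_ciSup hbdd n)
      calc a (n + 1) ≤ R * a n := h1
        _ ≤ R * (a 0 * R ^ n) := by gcongr
        _ = a 0 * R ^ (n + 1) := by ring
  have h0 : Tendsto (fun n : ℕ => a 0 * ((C : ℝ) + 1) ^ d * ((n : ℝ) ^ d * R ^ n)) atTop
      (𝓝 (a 0 * ((C : ℝ) + 1) ^ d * 0)) :=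
    (tendsto_pow_const_mul_const_pow_of_lt_one d hRpos.le hlt).const_mul _
  rw [mul_zero] at h0
  -- n ≥ 1 gives C n + 1 ≤ (C + 1) n below.
  obtain ⟨n, hn, hn1⟩ := ((h0.eventually_lt_const zero_lt_one).and (eventually_ge_atTop 1)).exists
  refine absurd (hpoly n) (not_le.2 (lt_of_le_of_lt ?_ hn))
  have hn1' : (1 : ℝ) ≤ n := by exact_mod_cast hn1
  calc a n * ((C : ℝ) * n + 1) ^ d
      ≤ (a 0 * R ^ n) * (((C : ℝ) + 1) * n) ^ d := by
        have := hpos 0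
        gcongr
        · exact hgeo n
        · nlinarith
    _ = _ := by rw [mul_pow]; ring

lemma Finset.sum_le_sum_of_forall_ne_zero_mem {ι : Type*} {h : ι → ℝ} (h0 : ∀ x, 0 ≤ h x)
    (s : Finset ι) {t : Finset ι} (ht : ∀ x, h x ≠ 0 → x ∈ t) :
    ∑ x ∈ s, h x ≤ ∑ x ∈ t, h x := by
  classical
  rw [← Finset.sum_filter_ne_zero s]
  exact Finset.sum_le_sum_of_subset_of_nonneg
    (fun x hx => ht x (Finset.mem_filter.1 hx).2) fun x _ _ => h0 x

namespace AddMonoidAlgebra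

variable {G : Type*} [AddCommGroup G]

/-- A finitely supported symmetric probability on an additive group. -/
structure IsSymmProb (w : AddMonoidAlgebra ℝ G) : Prop where
  nonneg : ∀ x, 0 ≤ w.coeff x
  symm : ∀ x, w.coeff (-x) = w.coeff x
  sum_eq_one : (w.coeff.sum fun _ r => r) = 1

lemma coeff_mul_eq_sum (f g : AddMonoidAlgebra ℝ G) (x : G) :
    (f * g).coeff x = ∑ a ∈ f.coeff.support, f.coeff a * g.coeff (x - a) := by
  rw [coeff_mul_apply_left, Finsupp.sum]
  exact Finset.sum_congr rfl fun a _ => by rw [neg_add_eq_sub]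

/-- Total mass is the augmentation, an algebra homomorphism. -/
lemma sum_coeff_mul (f g : AddMonoidAlgebra ℝ G) :
    ((f * g).coeff.sum fun _ r => r) = (f.coeff.sum fun _ r => r) * (g.coeff.sum fun _ r => r) := by
  have h : ∀ f : AddMonoidAlgebra ℝ G, (f.coeff.sum fun _ r => r) =
      AddMonoidAlgebra.lift ℝ ℝ G 1 f := by
    intro f
    rw [AddMonoidAlgebra.lift_apply]
    simp
  rw [h, h, h, map_mul]

lemma IsSymmProb.one : IsSymmProb (1 : AddMonoidAlgebra ℝ G) where
  nonneg x := by classical rw [one_def, coeff_single, Finsupp.single_apply]; split_ifs <;> norm_num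
  symm x := by
    classical
    rw [one_def, coeff_single, Finsupp.single_apply, Finsupp.single_apply]
    simp [eq_comm]
  sum_eq_one := by simp [one_def]

lemma IsSymmProb.mul {f g : AddMonoidAlgebra ℝ G} (hf : IsSymmProb f) (hg : IsSymmProb g) :
    IsSymmProb (f * g) where
  nonneg x := by
    rw [coeff_mul_eq_sum]
    exact Finset.sum_nonneg fun a _ => mul_nonneg (hf.nonneg _) (hg.nonneg _)
  symm x := by
    rw [coeff_mul_eq_sum, coeff_mul_eq_sum]
    refine Finset.sum_bij (fun a _ => -a) ?_ ?_ ?_ ?_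
    · intro a ha; simpa [hf.symm] using ha
    · intro a _ b _ h; simpa using h
    · intro b hb; exact ⟨-b, by simpa [hf.symm] using hb, by simp⟩
    · intro a _
      rw [hf.symm, ← hg.symm (x - -a)]
      congr 2; abel
  sum_eq_one := by rw [sum_coeff_mul, hf.sum_eq_one, hg.sum_eq_one, one_mul]

lemma IsSymmProb.pow {w : AddMonoidAlgebra ℝ G} (hw : IsSymmProb w) (n : ℕ) :
    IsSymmProb (w ^ n) := by
  induction n with
  | zero => simpa using IsSymmProb.one
  | succ n ih => rw [pow_succ]; exact ih.mul hw

lemma IsSymmProb.coeff_mul_self_zero {f : AddMonoidAlgebra ℝ G} (hf : IsSymmProb f) :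
    (f * f).coeff 0 = ∑ a ∈ f.coeff.support, f.coeff a ^ 2 := by
  rw [coeff_mul_eq_sum]
  exact Finset.sum_congr rfl fun a _ => by rw [zero_sub, hf.symm, sq]

/-- Cauchy–Schwarz for the convolution; symmetry identifies the two sums of squares with values at
0. -/
lemma IsSymmProb.sq_coeff_mul_le {f g : AddMonoidAlgebra ℝ G} (hf : IsSymmProb f)
    (hg : IsSymmProb g) (x : G) :
    (f * g).coeff x ^ 2 ≤ (f * f).coeff 0 * (g * g).coeff 0 := by
  classical
  rw [coeff_mul_eq_sum, hf.coeff_mul_self_zero, hg.coeff_mul_self_zero]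
  refine (Finset.sum_mul_sq_le_sq_mul_sq _ _ _).trans ?_
  refine mul_le_mul_of_nonneg_left ?_ (Finset.sum_nonneg fun _ _ => sq_nonneg _)
  rw [← Finset.sum_image (s := f.coeff.support) (g := fun a => x - a)
    (f := fun b => g.coeff b ^ 2) (fun a _ b _ h => by simpa using h)]
  exact Finset.sum_le_sum_of_forall_ne_zero_mem (fun _ => sq_nonneg _) _
    fun b hb => by simpa using hb

lemma IsSymmProb.sum_le_one {f : AddMonoidAlgebra ℝ G} (hf : IsSymmProb f) (s : Finset G) :
    ∑ a ∈ s, f.coeff a ≤ 1 := by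
  rw [← hf.sum_eq_one, Finsupp.sum]
  exact Finset.sum_le_sum_of_forall_ne_zero_mem hf.nonneg _ fun b hb => by simpa using hb

variable {w : AddMonoidAlgebra ℝ G}

lemma IsSymmProb.coeff_pow_even_le (hw : IsSymmProb w) (m : ℕ) (x : G) :
    (w ^ (2 * m)).coeff x ≤ (w ^ (2 * m)).coeff 0 := by
  have h := (hw.pow m).sq_coeff_mul_le (hw.pow m) x
  rw [← pow_add, ← two_mul, ← sq] at h
  exact (pow_le_pow_iff_left₀ ((hw.pow _).nonneg _) ((hw.pow _).nonneg _) two_ne_zero).1 h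

/-- The mass 1 is spread over the support, and no value exceeds the one at 0. -/
lemma IsSymmProb.one_le_card_mul_coeff (hw : IsSymmProb w) (m : ℕ) :
    1 ≤ ((w ^ (2 * m)).coeff.support.card : ℝ) * (w ^ (2 * m)).coeff 0 := by
  calc (1 : ℝ) = ∑ a ∈ (w ^ (2 * m)).coeff.support, (w ^ (2 * m)).coeff a :=
        (hw.pow _).sum_eq_one.symm
    _ ≤ ∑ _a ∈ (w ^ (2 * m)).coeff.support, (w ^ (2 * m)).coeff 0 :=
        Finset.sum_le_sum fun a _ => hw.coeff_pow_even_le m a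
    _ = _ := by simp

lemma IsSymmProb.coeff_pow_even_zero_pos (hw : IsSymmProb w) (m : ℕ) :
    0 < (w ^ (2 * m)).coeff 0 := by
  refine ((hw.pow _).nonneg 0).lt_of_ne fun h => ?_
  have := hw.one_le_card_mul_coeff m
  rw [← h, mul_zero] at this
  linarith

/-- `p_{2m+2k}(0)` is an average of the `p_{2m}(x)`, each of which is at most `p_{2m}(0)`. -/
lemma IsSymmProb.coeff_pow_add_le (hw : IsSymmProb w) (m k : ℕ) (z : G) :
    (w ^ (2 * (m + k))).coeff 0 ≤ (w ^ (2 * k)).coeff z * (w ^ (2 * m)).coeff z +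
      (1 - (w ^ (2 * k)).coeff z) * (w ^ (2 * m)).coeff 0 := by
  classical
  rw [show 2 * (m + k) = 2 * k + 2 * m by ring, pow_add, coeff_mul_eq_sum]
  set f := w ^ (2 * k)
  set g := w ^ (2 * m)
  have hf : IsSymmProb f := hw.pow _
  have hg : IsSymmProb g := hw.pow _
  -- Inserting `z` lets its term be split off even when its coefficient vanishes.
  have hS : ∑ a ∈ insert z f.coeff.support, f.coeff a * g.coeff (0 - a) =
      ∑ a ∈ f.coeff.support, f.coeff a * g.coeff (0 - a) := by
    refine (Finset.sum_subset (Finset.subset_insert _ _) fun a _ ha => ?_).symm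
    rw [Finsupp.notMem_support_iff.1 ha, zero_mul]
  have hz : z ∈ insert z f.coeff.support := Finset.mem_insert_self _ _
  rw [← hS, ← Finset.add_sum_erase _ _ hz, zero_sub, hg.symm]
  gcongr
  have h1 := hf.sum_le_one (insert z f.coeff.support)
  rw [← Finset.add_sum_erase _ _ hz] at h1
  calc ∑ a ∈ (insert z f.coeff.support).erase z, f.coeff a * g.coeff (0 - a)
      ≤ ∑ a ∈ (insert z f.coeff.support).erase z, f.coeff a * g.coeff 0 :=
        Finset.sum_le_sum fun a _ => mul_le_mul_of_nonneg_left (hw.coeff_pow_even_le m _)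
          (hf.nonneg a)
    _ = (∑ a ∈ (insert z f.coeff.support).erase z, f.coeff a) * g.coeff 0 :=
        (Finset.sum_mul ..).symm
    _ ≤ _ := mul_le_mul_of_nonneg_right (by linarith) (hg.nonneg 0)

variable {C d : ℕ}

lemma IsSymmProb.tendsto_return_ratio (hw : IsSymmProb w)
    (hgrowth : ∀ m, (w ^ (2 * m)).coeff.support.card ≤ (C * m + 1) ^ d) :
    Tendsto (fun m => (w ^ (2 * (m + 1))).coeff 0 / (w ^ (2 * m)).coeff 0) atTop (𝓝 1) := by
  refine tendsto_ratio_one_of_logConvex (a := fun m => (w ^ (2 * m)).coeff 0) (C := C) (d := d)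
    hw.coeff_pow_even_zero_pos (fun m => ?_) (fun m => ?_) (fun m => ?_)
  · have h := hw.coeff_pow_add_le m 1 0
    linarith
  -- Log-convexity is Cauchy–Schwarz for `w ^ m` and `w ^ (m + 2)`, whose product is `w ^ (2 * (m +
  -- 1))`.
  · have h := (hw.pow m).sq_coeff_mul_le (hw.pow (m + 2)) 0
    simp only [← pow_add] at h
    convert h using 4 <;> ring
  · have h1 := hw.one_le_card_mul_coeff m
    have h2 : ((w ^ (2 * m)).coeff.support.card : ℝ) ≤ ((C : ℝ) * m + 1) ^ d := by
      exact_mod_cast hgrowth m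
    have := hw.coeff_pow_even_zero_pos m
    nlinarith

lemma IsSymmProb.tendsto_return_ratio_add (hw : IsSymmProb w)
    (hgrowth : ∀ m, (w ^ (2 * m)).coeff.support.card ≤ (C * m + 1) ^ d) (k : ℕ) :
    Tendsto (fun m => (w ^ (2 * (m + k))).coeff 0 / (w ^ (2 * m)).coeff 0) atTop (𝓝 1) := by
  induction k with
  | zero =>
    refine tendsto_const_nhds.congr fun m => ?_
    rw [add_zero, div_self (hw.coeff_pow_even_zero_pos m).ne']
  | succ k ih =>
    have h := ((tendsto_add_atTop_iff_nat k).2 (hw.tendsto_return_ratio hgrowth)).mul ih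
    rw [mul_one] at h
    refine h.congr fun m => ?_
    have := (hw.coeff_pow_even_zero_pos (m + k)).ne'
    rw [← add_assoc]
    field_simp

/-- The ratio limit theorem at even times. -/
lemma IsSymmProb.tendsto_even_ratio (hw : IsSymmProb w)
    (hgrowth : ∀ m, (w ^ (2 * m)).coeff.support.card ≤ (C * m + 1) ^ d) {k : ℕ} {z : G}
    (hz : 0 < (w ^ (2 * k)).coeff z) :
    Tendsto (fun m => (w ^ (2 * m)).coeff z / (w ^ (2 * m)).coeff 0) atTop (𝓝 1) := by
  set q := (w ^ (2 * k)).coeff z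
  -- This lower bound is `coeff_pow_add_le` divided by the return probability and solved for the
  -- ratio at `z`.
  have hlow : Tendsto (fun m => 1 - (1 - (w ^ (2 * (m + k))).coeff 0 / (w ^ (2 * m)).coeff 0) / q)
      atTop (𝓝 (1 - (1 - 1) / q)) :=
    (((hw.tendsto_return_ratio_add hgrowth k).const_sub 1).div_const q).const_sub 1
  rw [sub_self, zero_div, sub_zero] at hlow
  refine tendsto_of_tendsto_of_tendsto_of_le_of_le hlow tendsto_const_nhds (fun m => ?_)
    (fun m => ?_)
  · have h0 := hw.coeff_pow_even_zero_pos m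
    have h := hw.coeff_pow_add_le m k z
    change 1 - (1 - (w ^ (2 * (m + k))).coeff 0 / (w ^ (2 * m)).coeff 0) / q ≤ _
    have h2 : (w ^ (2 * (m + k))).coeff 0 / (w ^ (2 * m)).coeff 0 ≤
        q * ((w ^ (2 * m)).coeff z / (w ^ (2 * m)).coeff 0) + (1 - q) := by
      rw [div_le_iff₀ h0]
      refine h.trans_eq ?_
      change q * _ + (1 - q) * _ = _
      field_simp
    rw [sub_le_comm, le_div_iff₀ hz]
    linarith
  · exact (div_le_one (hw.coeff_pow_even_zero_pos m)).2 (hw.coeff_pow_even_le m z)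

/-- The ratio limit theorem at odd times. -/
lemma IsSymmProb.tendsto_odd_ratio (hw : IsSymmProb w)
    (hgrowth : ∀ m, (w ^ (2 * m)).coeff.support.card ≤ (C * m + 1) ^ d) {z : G}
    (hz : ∀ a ∈ w.coeff.support, ∃ k, 0 < (w ^ (2 * k)).coeff (z - a)) :
    Tendsto (fun m => (w ^ (2 * m + 1)).coeff z / (w ^ (2 * m)).coeff 0) atTop (𝓝 1) := by
  -- Splitting off one step reduces odd times to even times at the points `z - a`.
  have h : Tendsto (fun m => ∑ a ∈ w.coeff.support,
      w.coeff a * ((w ^ (2 * m)).coeff (z - a) / (w ^ (2 * m)).coeff 0)) atTop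
      (𝓝 (∑ a ∈ w.coeff.support, w.coeff a * 1)) := by
    refine tendsto_finsetSum _ fun a ha => ?_
    obtain ⟨k, hk⟩ := hz a ha
    exact (hw.tendsto_even_ratio hgrowth hk).const_mul _
  simp only [mul_one] at h
  rw [show ∑ a ∈ w.coeff.support, w.coeff a = 1 from hw.sum_eq_one] at h
  refine h.congr fun m => ?_
  rw [pow_succ', coeff_mul_eq_sum, Finset.sum_div]
  exact Finset.sum_congr rfl fun a _ => by rw [mul_div_assoc]

end AddMonoidAlgebra

/-! ### Unit steps and the norm -/

section Norm

variable {d : ℕ}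

lemma l1Norm_add_single (x : Fin d → ℤ) (i : Fin d) (c : ℤ) :
    l1Norm (x + Pi.single i c) + (x i).natAbs = l1Norm x + (x i + c).natAbs := by
  unfold l1Norm
  rw [← Finset.add_sum_erase _ _ (Finset.mem_univ i),
    ← Finset.add_sum_erase _ (fun i => (x i).natAbs) (Finset.mem_univ i)]
  have : ∑ k ∈ Finset.univ.erase i, ((x + Pi.single i c : Fin d → ℤ) k).natAbs =
      ∑ k ∈ Finset.univ.erase i, (x k).natAbs :=
    Finset.sum_congr rfl fun k hk => by simp [Finset.ne_of_mem_erase hk]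
  rw [this]
  simp
  ring

lemma natAbs_le_l1Norm (x : Fin d → ℤ) (i : Fin d) : (x i).natAbs ≤ l1Norm x :=
  Finset.single_le_sum (f := fun i => (x i).natAbs) (fun _ _ => Nat.zero_le _) (Finset.mem_univ i)

lemma l1Norm_eq_zero {x : Fin d → ℤ} : l1Norm x = 0 ↔ x = 0 := by
  simp [l1Norm, Finset.sum_eq_zero_iff, funext_iff]

/-- The vectors `1_i` and `-1_i`. -/
def IsUnitStep (a : Fin d → ℤ) : Prop :=
  ∃ i, a = Pi.single i 1 ∨ a = -Pi.single i 1

lemma IsUnitStep.l1Norm_add {a : Fin d → ℤ} (ha : IsUnitStep a) (x : Fin d → ℤ) :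
    l1Norm (x + a) = l1Norm x + 1 ∨ l1Norm (x + a) + 1 = l1Norm x := by
  obtain ⟨i, rfl | rfl⟩ := ha
  · have := l1Norm_add_single x i 1
    omega
  · rw [← Pi.single_neg]
    have := l1Norm_add_single x i (-1)
    omega

lemma l1Norm_add_single_one_eq_iff (x : Fin d → ℤ) (i : Fin d) :
    l1Norm (x + Pi.single i 1) = l1Norm x + 1 ↔ 0 ≤ x i := by
  have := l1Norm_add_single x i 1
  omega

lemma l1Norm_add_neg_single_one_eq_iff (x : Fin d → ℤ) (i : Fin d) :
    l1Norm (x + -Pi.single i 1) = l1Norm x + 1 ↔ x i ≤ 0 := by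
  rw [← Pi.single_neg]
  have := l1Norm_add_single x i (-1)
  omega

/-- Every nonzero vector is one unit step away from a vector of smaller norm. -/
lemma exists_unitStep_l1Norm_sub {x : Fin d → ℤ} (hx : l1Norm x ≠ 0) :
    ∃ a, IsUnitStep a ∧ l1Norm (x - a) + 1 = l1Norm x := by
  obtain ⟨i, hi⟩ : ∃ i, x i ≠ 0 := by
    by_contra! h
    exact hx (l1Norm_eq_zero.2 (funext h))
  rcases lt_or_gt_of_ne hi with h | h
  · refine ⟨-Pi.single i 1, ⟨i, Or.inr rfl⟩, ?_⟩
    rw [sub_neg_eq_add]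
    have := l1Norm_add_single x i 1
    omega
  · refine ⟨Pi.single i 1, ⟨i, Or.inl rfl⟩, ?_⟩
    rw [sub_eq_add_neg, ← Pi.single_neg]
    have := l1Norm_add_single x i (-1)
    omega

end Norm

/-! ### The step law: support, parity and ratio limit -/

section StepLaw

open AddMonoidAlgebra

variable {d : ℕ} {α : Fin d → ℝ}

/-- The law of a step of the symmetric random walk with parameter `α`. -/
def stepLaw (α : Fin d → ℝ) : AddMonoidAlgebra ℝ (Fin d → ℤ) :=
  ∑ i, (single (Pi.single i 1) (α i) + single (-Pi.single i 1) (α i))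

lemma sum_stepLaw (α : Fin d → ℝ) (φ : (Fin d → ℤ) → ℝ) :
    ((stepLaw α).coeff.sum fun a r => r * φ a) =
      ∑ i, (α i * φ (Pi.single i 1) + α i * φ (-Pi.single i 1)) := by
  have h : ((stepLaw α).coeff.sum fun a r => r * φ a) =
      Finsupp.linearCombination ℝ φ (stepLaw α).coeff := by
    simp [Finsupp.linearCombination_apply]
  rw [h, stepLaw, coeff_sum, map_sum]
  simp

lemma stepLaw_coeff (α : Fin d → ℝ) (x : Fin d → ℤ) :
    (stepLaw α).coeff x = ∑ i, ((if (Pi.single i 1 : Fin d → ℤ) = x then α i else 0) +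
      (if (-Pi.single i 1 : Fin d → ℤ) = x then α i else 0)) := by
  simp [stepLaw, Finsupp.single_apply]

lemma stepLaw_coeff_single (α : Fin d → ℝ) (i : Fin d) :
    (stepLaw α).coeff (Pi.single i 1) = α i := by
  rw [stepLaw_coeff, Finset.sum_eq_single i]
  · rw [if_pos rfl, if_neg, add_zero]
    intro h
    simpa using congrFun h i
  · intro k _ hk
    rw [if_neg, if_neg, add_zero]
    · intro h
      simpa [hk.symm] using congrFun h i
    · intro h
      simpa [hk.symm] using congrFun h i
  · simp

lemma stepLaw_coeff_neg (α : Fin d → ℝ) (x : Fin d → ℤ) :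
    (stepLaw α).coeff (-x) = (stepLaw α).coeff x := by
  rw [stepLaw_coeff, stepLaw_coeff]
  refine Finset.sum_congr rfl fun i _ => ?_
  rw [add_comm]
  simp only [neg_eq_iff_eq_neg, neg_neg]

lemma isUnitStep_of_mem_support {a : Fin d → ℤ} (ha : a ∈ (stepLaw α).coeff.support) :
    IsUnitStep a := by
  rw [Finsupp.mem_support_iff, stepLaw_coeff] at ha
  obtain ⟨i, _, hi⟩ := Finset.exists_ne_zero_of_sum_ne_zero ha
  refine ⟨i, ?_⟩
  by_contra! h
  rw [if_neg h.1.symm, if_neg h.2.symm, add_zero] at hi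
  exact hi rfl

lemma stepLaw_coeff_pos (hα : α ∈ symmetricParams d) {a : Fin d → ℤ} (ha : IsUnitStep a) :
    0 < (stepLaw α).coeff a := by
  obtain ⟨i, rfl | rfl⟩ := ha
  · rw [stepLaw_coeff_single]; exact hα.1 i
  · rw [stepLaw_coeff_neg, stepLaw_coeff_single]; exact hα.1 i

lemma isSymmProb_stepLaw (hα : α ∈ symmetricParams d) : IsSymmProb (stepLaw α) where
  nonneg x := by
    rw [stepLaw_coeff]
    refine Finset.sum_nonneg fun i _ => ?_
    have := (hα.1 i).le
    split_ifs <;> linarith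
  symm := stepLaw_coeff_neg α
  sum_eq_one := by
    have h := sum_stepLaw α fun _ => 1
    simp only [mul_one] at h
    rw [h, ← hα.2, Finset.mul_sum]
    exact Finset.sum_congr rfl fun i _ => by ring

lemma l1Norm_of_stepLaw_pow_ne_zero {t : ℕ} {x : Fin d → ℤ}
    (h : ((stepLaw α) ^ t).coeff x ≠ 0) : l1Norm x ≤ t ∧ t % 2 = l1Norm x % 2 := by
  induction t generalizing x with
  | zero =>
    have : x = 0 := by
      by_contra hx
      exact h (by rw [pow_zero, one_def, coeff_single, Finsupp.single_eq_of_ne hx])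
    simp [l1Norm_eq_zero.2 this]
  | succ t ih =>
    rw [pow_succ', coeff_mul_eq_sum] at h
    obtain ⟨a, ha, hne⟩ := Finset.exists_ne_zero_of_sum_ne_zero h
    have h1 := ih (right_ne_zero_of_mul hne)
    have h2 := (isUnitStep_of_mem_support ha).l1Norm_add (x - a)
    rw [sub_add_cancel] at h2
    omega

lemma card_support_stepLaw_pow (α : Fin d → ℝ) (m : ℕ) :
    ((stepLaw α) ^ (2 * m)).coeff.support.card ≤ (4 * m + 1) ^ d := by
  -- The support lies in a cube of side 4m + 1, hence `C = 4` in the growth condition.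
  have hsub : ((stepLaw α) ^ (2 * m)).coeff.support ⊆
      Fintype.piFinset fun _ => Finset.Icc (-(2 * m : ℤ)) (2 * m) := by
    intro x hx
    rw [Fintype.mem_piFinset]
    intro i
    have h1 := (l1Norm_of_stepLaw_pow_ne_zero (Finsupp.mem_support_iff.1 hx)).1
    have h2 := natAbs_le_l1Norm x i
    rw [Finset.mem_Icc]
    omega
  refine (Finset.card_le_card hsub).trans_eq ?_
  rw [Fintype.card_piFinset, Finset.prod_const, Finset.card_univ, Fintype.card_fin, Int.card_Icc]
  congr 1
  omega

/-- A shortest path from 0 to `x` has positive probability. -/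
lemma stepLaw_pow_l1Norm_pos (hα : α ∈ symmetricParams d) (x : Fin d → ℤ) :
    0 < ((stepLaw α) ^ l1Norm x).coeff x := by
  have hw := isSymmProb_stepLaw hα
  induction hn : l1Norm x generalizing x with
  | zero => simp [l1Norm_eq_zero.1 hn, one_def]
  | succ n ih =>
    obtain ⟨a, ha, hxa⟩ := exists_unitStep_l1Norm_sub (x := x) (by omega)
    have h1 := ih (x - a) (by omega)
    have h2 := stepLaw_coeff_pos hα ha
    rw [pow_succ', coeff_mul_eq_sum]
    refine (mul_pos h2 h1).trans_le ?_
    exact Finset.single_le_sum (f := fun a => (stepLaw α).coeff a * ((stepLaw α) ^ n).coeff (x - a))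
      (fun a _ => mul_nonneg (hw.nonneg _) ((hw.pow n).nonneg _))
      (Finsupp.mem_support_iff.2 h2.ne')

/-- The ratio limit theorem for symmetric random walks: after renormalization by a return
probability, the probabilities of all states of the right parity tend to `1`. -/
lemma tendsto_stepLaw_ratio (hα : α ∈ symmetricParams d) (x : Fin d → ℤ) :
    Tendsto (fun j => ((stepLaw α) ^ j).coeff x / ((stepLaw α) ^ (2 * (j / 2))).coeff 0)
      (atTop ⊓ 𝓟 {j | j % 2 = l1Norm x % 2}) (𝓝 1) := by
  have hw := isSymmProb_stepLaw hα
  have hgrowth := card_support_stepLaw_pow α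
  have heven : ∀ y : Fin d → ℤ, l1Norm y % 2 = 0 →
      ∃ k, 0 < ((stepLaw α) ^ (2 * k)).coeff y := fun y hy =>
    ⟨l1Norm y / 2, by
      rw [Nat.mul_div_cancel' (Nat.dvd_of_mod_eq_zero hy)]; exact stepLaw_pow_l1Norm_pos hα y⟩
  have hhalf : Tendsto (fun j : ℕ => j / 2) (atTop ⊓ 𝓟 {j | j % 2 = l1Norm x % 2}) atTop :=
    (Nat.tendsto_div_const_atTop two_ne_zero).mono_left inf_le_left
  rcases Nat.mod_two_eq_zero_or_one (l1Norm x) with h | h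
  · obtain ⟨k, hk⟩ := heven x h
    refine ((hw.tendsto_even_ratio hgrowth hk).comp hhalf).congr' ?_
    refine eventually_inf_principal.2 (Eventually.of_forall fun j (hj : j % 2 = _) => ?_)
    have : 2 * (j / 2) = j := by omega
    simp only [Function.comp_apply, this]
  · refine ((hw.tendsto_odd_ratio hgrowth (z := x) fun a ha => heven _ ?_).comp hhalf).congr' ?_
    · have h2 := (isUnitStep_of_mem_support ha).l1Norm_add (x - a)
      rw [sub_add_cancel] at h2
      omega
    · refine eventually_inf_principal.2 (Eventually.of_forall fun j (hj : j % 2 = _) => ?_)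
      have : 2 * (j / 2) + 1 = j := by omega
      rw [Function.comp_apply, this]

end StepLaw

/-! ### Counting points on spheres -/

/-- The vectors of `ℤᵈ` of norm `n`. -/
def l1Sphere (d n : ℕ) : Finset (Fin d → ℤ) :=
  (Fintype.piFinset fun _ => Finset.Icc (-(n : ℤ)) n).filter fun x => l1Norm x = n

lemma mem_l1Sphere {d n : ℕ} {x : Fin d → ℤ} : x ∈ l1Sphere d n ↔ l1Norm x = n := by
  rw [l1Sphere, Finset.mem_filter, and_iff_right_iff_imp, Fintype.mem_piFinset]
  rintro rfl i
  have := natAbs_le_l1Norm x i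
  rw [Finset.mem_Icc]
  omega

lemma l1Norm_insertNth {d : ℕ} (i : Fin (d + 1)) (z : ℤ) (y : Fin d → ℤ) :
    l1Norm (i.insertNth z y : Fin (d + 1) → ℤ) = z.natAbs + l1Norm y := by
  rw [l1Norm, Fin.sum_univ_succAbove _ i]
  simp [l1Norm]

lemma card_l1Sphere_filter_eq {d n : ℕ} (i : Fin (d + 1)) (z : ℤ) (hz : z.natAbs ≤ n) :
    ((l1Sphere (d + 1) n).filter fun x => x i = z).card = (l1Sphere d (n - z.natAbs)).card := by
  symm
  refine Finset.card_bij (fun y _ => (i.insertNth z y : Fin (d + 1) → ℤ)) ?_ ?_ ?_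
  · intro y hy
    rw [mem_l1Sphere] at hy
    rw [Finset.mem_filter, mem_l1Sphere, l1Norm_insertNth]
    exact ⟨by omega, by simp⟩
  · intro y _ y' _ h
    exact Fin.insertNth_right_injective (α := fun _ => ℤ) z h
  · intro x hx
    rw [Finset.mem_filter, mem_l1Sphere] at hx
    have hx' : (i.insertNth z (i.removeNth x) : Fin (d + 1) → ℤ) = x := by
      rw [← hx.2]; exact Fin.insertNth_self_removeNth i x
    refine ⟨i.removeNth x, ?_, hx'⟩
    have h := hx.1
    rw [← hx', l1Norm_insertNth] at h
    rw [mem_l1Sphere]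
    omega

lemma sum_Icc_neg_natAbs (f : ℕ → ℕ) (n : ℕ) :
    ∑ z ∈ Finset.Icc (-(n : ℤ)) n, f z.natAbs = f 0 + 2 * ∑ k ∈ Finset.range n, f (k + 1) := by
  induction n with
  | zero => simp
  | succ n ih =>
    have h : Finset.Icc (-((n + 1 : ℕ) : ℤ)) (n + 1 : ℕ) =
        insert (-((n + 1 : ℕ) : ℤ)) (insert ((n + 1 : ℕ) : ℤ) (Finset.Icc (-(n : ℤ)) n)) := by
      ext z
      simp only [Finset.mem_insert, Finset.mem_Icc]
      omega
    rw [h, Finset.sum_insert, Finset.sum_insert, ih, Finset.sum_range_succ]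
    · simp only [Int.natAbs_neg, Int.natAbs_natCast]; ring
    · simp
    · simp only [Finset.mem_insert, Finset.mem_Icc]; omega

lemma card_l1Sphere_zero (d : ℕ) : (l1Sphere d 0).card = 1 := by
  rw [Finset.card_eq_one]
  refine ⟨0, ?_⟩
  ext x
  simp [mem_l1Sphere, l1Norm, Finset.sum_eq_zero_iff, funext_iff]

/-- Slice by the first coordinate z: slices z and -z are equinumerous, and the summand 2 comes from
the one-point slices z = ±(n + 1). -/
lemma card_l1Sphere_dim_succ (d n : ℕ) :
    (l1Sphere (d + 1) (n + 1)).card =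
      (l1Sphere d (n + 1)).card + 2 + 2 * ∑ k ∈ Finset.range n, (l1Sphere d (k + 1)).card := by
  have hmaps : ∀ x ∈ l1Sphere (d + 1) (n + 1),
      x 0 ∈ Finset.Icc (-((n + 1 : ℕ) : ℤ)) (n + 1 : ℕ) := by
    intro x hx
    rw [l1Sphere, Finset.mem_filter, Fintype.mem_piFinset] at hx
    exact hx.1 0
  rw [Finset.card_eq_sum_card_fiberwise hmaps]
  rw [Finset.sum_congr rfl fun z hz => card_l1Sphere_filter_eq 0 z
    (by rw [Finset.mem_Icc] at hz; omega),
    sum_Icc_neg_natAbs fun k => (l1Sphere d (n + 1 - k)).card]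
  have h : ∑ k ∈ Finset.range (n + 1), (l1Sphere d (n + 1 - (k + 1))).card =
      ∑ k ∈ Finset.range (n + 1), (l1Sphere d k).card := by
    rw [← Finset.sum_range_reflect]
    refine Finset.sum_congr rfl fun k hk => ?_
    rw [Finset.mem_range] at hk
    congr 2
    omega
  rw [h, Finset.sum_range_succ', card_l1Sphere_zero, Nat.sub_zero]
  ring

lemma sum_range_choose_hockeyStick (n j : ℕ) :
    ∑ k ∈ Finset.range n, k.choose j = n.choose (j + 1) := by
  induction n with
  | zero => simp
  | succ n ih => rw [Finset.sum_range_succ, ih, Nat.choose_succ_succ, add_comm]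

/-- The number of vectors of norm `n + 1`, sorted by the number `i` of their nonzero
coordinates. -/
lemma card_l1Sphere_succ (d n : ℕ) :
    (l1Sphere d (n + 1)).card =
      ∑ i ∈ Finset.range d, 2 ^ (i + 1) * d.choose (i + 1) * n.choose i := by
  induction d generalizing n with
  | zero =>
    rw [Finset.sum_range_zero, Finset.card_eq_zero]
    ext x
    simp [mem_l1Sphere, l1Norm]
  | succ d ih =>
    have h1 : ∑ k ∈ Finset.range n, (l1Sphere d (k + 1)).card =
        ∑ i ∈ Finset.range d, 2 ^ (i + 1) * d.choose (i + 1) * n.choose (i + 1) := by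
      rw [Finset.sum_congr rfl fun k _ => ih k, Finset.sum_comm]
      refine Finset.sum_congr rfl fun i _ => ?_
      rw [← Finset.mul_sum, sum_range_choose_hockeyStick]
    -- `h2` and `h3` are the two halves of the target sum under Pascal's rule for `(d + 1).choose (i
    -- + 1)`.
    have h2 : ∑ i ∈ Finset.range (d + 1), 2 ^ (i + 1) * d.choose (i + 1) * n.choose i =
        ∑ i ∈ Finset.range d, 2 ^ (i + 1) * d.choose (i + 1) * n.choose i := by
      rw [Finset.sum_range_succ, Nat.choose_succ_self]; simp
    have h3 : ∑ i ∈ Finset.range (d + 1), 2 ^ (i + 1) * d.choose i * n.choose i =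
        2 + 2 * ∑ i ∈ Finset.range d, 2 ^ (i + 1) * d.choose (i + 1) * n.choose (i + 1) := by
      rw [Finset.sum_range_succ', Finset.mul_sum, add_comm]
      simp only [zero_add, pow_one, Nat.choose_zero_right, mul_one]
      congr 1
      exact Finset.sum_congr rfl fun i _ => by ring
    rw [card_l1Sphere_dim_succ, ih, h1, add_assoc, ← h3, ← h2, ← Finset.sum_add_distrib]
    refine Finset.sum_congr rfl fun i _ => ?_
    rw [Nat.choose_succ_succ]
    ring

lemma card_l1Sphere_filter_zero {d n : ℕ} (i : Fin (d + 1)) :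
    ((l1Sphere (d + 1) n).filter fun x => x i = 0).card = (l1Sphere d n).card := by
  simpa using card_l1Sphere_filter_eq (n := n) i 0 (by simp)

lemma sum_Icc_one_eq_sum_range (f : ℕ → ℝ) (n : ℕ) :
    ∑ i ∈ Finset.Icc 1 n, f i = ∑ i ∈ Finset.range n, f (i + 1) := by
  induction n with
  | zero => simp
  | succ n ih => rw [Finset.sum_Icc_succ_top (by omega), ih, Finset.sum_range_succ]

/-- Double counting: both sides count pairs of a sphere point and one of its nonzero coordinates,
that is, the inward unit moves. -/
lemma bdDeath_succ (d n : ℕ) :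
    bdDeath 2 (d + 1) (n + 1) =
      ((d : ℝ) + 1) * ((l1Sphere (d + 1) (n + 1)).card - (l1Sphere d (n + 1)).card) := by
  have h : ((l1Sphere d (n + 1)).card : ℝ) =
      ∑ i ∈ Finset.range (d + 1), (2 : ℝ) ^ (i + 1) * d.choose (i + 1) * n.choose i := by
    rw [card_l1Sphere_succ, Finset.sum_range_succ, Nat.choose_succ_self]
    push_cast
    simp
  rw [bdDeath, if_neg n.succ_ne_zero, sum_Icc_one_eq_sum_range, h, card_l1Sphere_succ]
  push_cast
  rw [← Finset.sum_sub_distrib, Finset.mul_sum]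
  refine Finset.sum_congr rfl fun i _ => ?_
  have h1 : ((d : ℝ) + 1) * d.choose i = (d + 1).choose (i + 1) * ((i : ℝ) + 1) := by
    exact_mod_cast Nat.add_one_mul_choose_eq d i
  have h2 : ((d + 1).choose (i + 1) : ℝ) = d.choose i + d.choose (i + 1) := by
    exact_mod_cast Nat.choose_succ_succ d i
  linear_combination (-(2 : ℝ) ^ (i + 1) * n.choose i) * h1 -
    ((d : ℝ) + 1) * 2 ^ (i + 1) * n.choose i * h2

/-- The rate counts outward unit moves: one for each nonzero coordinate, and two, whence the factor
γ = 2, for each zero coordinate. -/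
lemma bdBirth_succ (lam0 : ℝ) (d n : ℕ) :
    bdBirth lam0 2 (d + 1) (n + 1) =
      ((d : ℝ) + 1) * ((l1Sphere (d + 1) (n + 1)).card + (l1Sphere d (n + 1)).card) := by
  have hdeath := bdDeath_succ d n
  rw [bdDeath, if_neg n.succ_ne_zero] at hdeath
  rw [bdBirth, if_neg n.succ_ne_zero, hdeath, Nat.add_sub_cancel, sum_Icc_one_eq_sum_range]
  have h : ∑ i ∈ Finset.range d, (((d + 1 : ℕ) : ℝ) - (i + 1 : ℕ)) * 2 ^ (i + 1) *
      ((d + 1).choose (i + 1) : ℝ) * ((n + 1 - 1).choose (i + 1 - 1) : ℝ) =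
      ((d : ℝ) + 1) * (l1Sphere d (n + 1)).card := by
    rw [card_l1Sphere_succ]
    push_cast
    rw [Finset.mul_sum]
    refine Finset.sum_congr rfl fun i _ => ?_
    have h1 : ((d : ℝ) + 1) * d.choose i = (d + 1).choose (i + 1) * ((i : ℝ) + 1) := by
      exact_mod_cast Nat.add_one_mul_choose_eq d i
    have h2 : ((d + 1).choose (i + 1) : ℝ) = d.choose i + d.choose (i + 1) := by
      exact_mod_cast Nat.choose_succ_succ d i
    linear_combination (2 : ℝ) ^ (i + 1) * n.choose i * h1 +
      ((d : ℝ) + 1) * 2 ^ (i + 1) * n.choose i * h2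
  rw [h]
  ring

/-! ### Upward probabilities and the law of the walk -/

section Walk

open AddMonoidAlgebra

/-- The probability that a step of the walk from `x` increases the norm. -/
def upWeight {d : ℕ} (α : Fin d → ℝ) (x : Fin d → ℤ) : ℝ :=
  (stepLaw α).coeff.sum fun a r => r * if l1Norm (x + a) = l1Norm x + 1 then 1 else 0

/-- Along a nonzero coordinate exactly one of the two signs leads outward; along a zero coordinate
both do. -/
lemma upWeight_eq {d : ℕ} (α : Fin d → ℝ) (x : Fin d → ℤ) :
    upWeight α x = ∑ i, α i * (1 + if x i = 0 then 1 else 0) := by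
  rw [upWeight, sum_stepLaw]
  refine Finset.sum_congr rfl fun i _ => ?_
  simp only [l1Norm_add_single_one_eq_iff, l1Norm_add_neg_single_one_eq_iff]
  rcases lt_trichotomy (x i) 0 with h | h | h
  · simp [h.le, h.not_ge, h.ne]
  · simp [h]; ring
  · simp [h.le, h.not_ge, h.ne']

/-- Conservativity originates here: the number of sphere points with x_i = 0 does not depend on i,
so only the sum of the `α i` survives. -/
lemma sum_upWeight {d n : ℕ} {α : Fin (d + 1) → ℝ} (hα : α ∈ symmetricParams (d + 1)) :
    2 * ∑ x ∈ l1Sphere (d + 1) n, upWeight α x =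
      (l1Sphere (d + 1) n).card + (l1Sphere d n).card := by
  have h : ∀ i, ∑ x ∈ l1Sphere (d + 1) n, α i * ((1 : ℝ) + if x i = 0 then 1 else 0) =
      α i * ((l1Sphere (d + 1) n).card + (l1Sphere d n).card) := by
    intro i
    rw [← Finset.mul_sum, Finset.sum_add_distrib, Finset.sum_boole, card_l1Sphere_filter_zero]
    simp
  rw [Finset.sum_congr rfl fun x _ => upWeight_eq α x, Finset.sum_comm,
    Finset.sum_congr rfl fun i _ => h i, ← Finset.sum_mul, ← mul_assoc, hα.2, one_mul]

lemma l1Sphere_nonempty (d n : ℕ) : (l1Sphere (d + 1) n).Nonempty := by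
  refine ⟨Pi.single 0 (n : ℤ), ?_⟩
  have := l1Norm_add_single (0 : Fin (d + 1) → ℤ) 0 (n : ℤ)
  rw [zero_add, l1Norm_eq_zero.2 rfl] at this
  simpa [mem_l1Sphere] using this

/-- The birth probability in state `n` of `BD(2, d + 1)` is the average of the upward probabilities
over the vectors of norm `n`. -/
lemma birth_probability_eq {d n : ℕ} {lam0 : ℝ} (hlam0 : 0 < lam0) {α : Fin (d + 1) → ℝ}
    (hα : α ∈ symmetricParams (d + 1)) :
    bdBirth lam0 2 (d + 1) n / (bdBirth lam0 2 (d + 1) n + bdDeath 2 (d + 1) n) =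
      (∑ x ∈ l1Sphere (d + 1) n, upWeight α x) / (l1Sphere (d + 1) n).card := by
  have h := sum_upWeight (n := n) hα
  have hN : (0 : ℝ) < (l1Sphere (d + 1) n).card := by
    exact_mod_cast (l1Sphere_nonempty d n).card_pos
  cases n with
  | zero =>
    rw [card_l1Sphere_zero, card_l1Sphere_zero] at h
    rw [bdBirth, bdDeath, if_pos rfl, if_pos rfl, add_zero, div_self hlam0.ne',
      card_l1Sphere_zero]
    push_cast at h ⊢
    linarith
  | succ n =>
    have hd : (0 : ℝ) < (d : ℝ) + 1 := by positivity
    -- After cancelling d + 1, birth plus death is twice the size of the sphere.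
    rw [bdBirth_succ, bdDeath_succ, ← h, ← mul_add, mul_div_mul_left _ _ hd.ne']
    rw [show 2 * ∑ x ∈ l1Sphere (d + 1) (n + 1), upWeight α x +
        (((l1Sphere (d + 1) (n + 1)).card : ℝ) - (l1Sphere d (n + 1)).card) =
        2 * (l1Sphere (d + 1) (n + 1)).card by rw [h]; ring]
    rw [mul_div_mul_left _ _ two_ne_zero]

lemma activeTime_eq_self {d : ℕ} {s : ℕ → Fin d → ℤ}
    (hs : ∀ t, IsUnitStep (s (t + 1) - s t)) (j : ℕ) : activeTime s j = j := by
  induction j with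
  | zero => rfl
  | succ j ih =>
    rw [activeTime, ih]
    have hne : l1Norm (s (j + 1)) ≠ l1Norm (s j) := by
      have := (hs j).l1Norm_add (s j)
      rw [add_sub_cancel] at this
      omega
    exact le_antisymm (Nat.sInf_le ⟨j.lt_succ_self, hne⟩)
      (le_csInf ⟨j + 1, j.lt_succ_self, hne⟩ fun t ht => ht.1)

lemma setOf_l1Norm_eq {d : ℕ} {Ω : Type*} (S : ℕ → Ω → Fin d → ℤ) (t n : ℕ) :
    {ω | l1Norm (S t ω) = n} = S t ⁻¹' (l1Sphere d n : Set (Fin d → ℤ)) := by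
  ext ω
  simp [mem_l1Sphere]

namespace IsSymmetricWalk

variable {d : ℕ} {Ω : Type*} [MeasurableSpace Ω] {P : Measure Ω}
  {α : Fin d → ℝ} {S : ℕ → Ω → Fin d → ℤ}

lemma measurable_step (hS : IsSymmetricWalk P α S) (t : ℕ) :
    Measurable fun ω => S (t + 1) ω - S t ω :=
  (hS.measurable (t + 1)).sub (hS.measurable t)

lemma real_step_of_isUnitStep (hS : IsSymmetricWalk P α S) (t : ℕ) {a : Fin d → ℤ}
    (ha : IsUnitStep a) :
    P.real ((fun ω => S (t + 1) ω - S t ω) ⁻¹' {a}) = (stepLaw α).coeff a := by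
  obtain ⟨i, rfl | rfl⟩ := ha
  · rw [stepLaw_coeff_single]; exact hS.step_pos t i
  · rw [stepLaw_coeff_neg, stepLaw_coeff_single]; exact hS.step_neg t i

lemma measurableSet_l1Norm_eq (hS : IsSymmetricWalk P α S) (t n : ℕ) :
    MeasurableSet {ω | l1Norm (S t ω) = n} := by
  rw [setOf_l1Norm_eq]
  exact hS.measurable t (Finset.measurableSet _)

lemma indepFun_step (hS : IsSymmetricWalk P α S) (t : ℕ) :
    IndepFun (S t) (fun ω => S (t + 1) ω - S t ω) P := by
  have h := hS.indep.indepFun_sum_range_succ hS.measurable_step t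
  have hsum : ∑ j ∈ Finset.range t, (fun ω => S (j + 1) ω - S j ω) = S t := by
    ext1 ω
    rw [Finset.sum_apply, Finset.sum_range_sub (fun t => S t ω), hS.start, sub_zero]
  rwa [hsum] at h

variable [IsProbabilityMeasure P]

/-- The prescribed point masses already add up to 1. -/
lemma ae_step_mem_support (hS : IsSymmetricWalk P α S) (hα : α ∈ symmetricParams d) (t : ℕ) :
    ∀ᵐ ω ∂P, S (t + 1) ω - S t ω ∈ (stepLaw α).coeff.support := by
  have hm := hS.measurable_step t
  have h := sum_measureReal_preimage_singleton (μ := P) (f := fun ω => S (t + 1) ω - S t ω)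
    (stepLaw α).coeff.support (fun y _ => hm (measurableSet_singleton y))
  rw [Finset.sum_congr rfl fun a ha => hS.real_step_of_isUnitStep t (isUnitStep_of_mem_support ha),
    show ∑ a ∈ (stepLaw α).coeff.support, (stepLaw α).coeff a = 1 from
      (isSymmProb_stepLaw hα).sum_eq_one] at h
  have h1 : P ((fun ω => S (t + 1) ω - S t ω) ⁻¹' (stepLaw α).coeff.support) = 1 := by
    rw [← ENNReal.toReal_eq_one_iff]; exact h.symm
  exact (mem_ae_iff_prob_eq_one₀ (hm (Finset.measurableSet _)).nullMeasurableSet).2 h1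

/-- Decomposition of a probability according to the next step. -/
lemma real_eq_sum_inter_step (hS : IsSymmetricWalk P α S) (hα : α ∈ symmetricParams d) (t : ℕ)
    {A : Set Ω} (hA : MeasurableSet A) :
    P.real A = ∑ a ∈ (stepLaw α).coeff.support,
      P.real (A ∩ (fun ω => S (t + 1) ω - S t ω) ⁻¹' {a}) := by
  have hm := hS.measurable_step t
  rw [← measureReal_biUnion_finset]
  · refine measureReal_congr ?_
    filter_upwards [hS.ae_step_mem_support hα t] with ω hω
    refine propext ⟨fun h => ?_, fun h => ?_⟩
    · exact Set.mem_biUnion hω ⟨h, rfl⟩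
    · obtain ⟨a, _, h, _⟩ := Set.mem_iUnion₂.1 h
      exact h
  · intro a _ b _ hab
    exact (Disjoint.preimage _ (Set.disjoint_singleton.2 hab)).mono Set.inter_subset_right
      Set.inter_subset_right
  · exact fun a _ => hA.inter (hm (measurableSet_singleton a))

lemma real_inter_step (hS : IsSymmetricWalk P α S) (t : ℕ) (x : Fin d → ℤ) {a : Fin d → ℤ}
    (ha : IsUnitStep a) :
    P.real (S t ⁻¹' {x} ∩ (fun ω => S (t + 1) ω - S t ω) ⁻¹' {a}) =
      P.real (S t ⁻¹' {x}) * (stepLaw α).coeff a := by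
  rw [← hS.real_step_of_isUnitStep t ha, measureReal_def,
    (hS.indepFun_step t).measure_inter_preimage_eq_mul _ _ (measurableSet_singleton x)
      (measurableSet_singleton a), ENNReal.toReal_mul]
  rfl

lemma real_eq_coeff (hS : IsSymmetricWalk P α S) (hα : α ∈ symmetricParams d) (t : ℕ)
    (x : Fin d → ℤ) : P.real (S t ⁻¹' {x}) = ((stepLaw α) ^ t).coeff x := by
  induction t generalizing x with
  | zero =>
    have h0 : S 0 = fun _ => 0 := funext hS.start
    rw [h0, pow_zero, one_def, coeff_single]
    by_cases hx : x = 0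
    · simp [hx]
    · rw [Finsupp.single_eq_of_ne hx, Set.preimage_const_of_notMem (by simpa using Ne.symm hx)]
      simp
  | succ t ih =>
    rw [hS.real_eq_sum_inter_step hα t (hS.measurable (t + 1) (measurableSet_singleton x)),
      pow_succ', coeff_mul_eq_sum]
    refine Finset.sum_congr rfl fun a ha => ?_
    rw [← ih, mul_comm, ← hS.real_inter_step t _ (isUnitStep_of_mem_support ha)]
    congr 1
    ext ω
    simp only [Set.mem_inter_iff, Set.mem_preimage, Set.mem_singleton_iff]
    constructor
    · rintro ⟨h, h'⟩
      exact ⟨by rw [← h', h]; abel, h'⟩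
    · rintro ⟨h, h'⟩
      exact ⟨by rw [h, sub_eq_iff_eq_add] at h'; rw [h']; abel, h'⟩

lemma real_l1Norm_eq (hS : IsSymmetricWalk P α S) (hα : α ∈ symmetricParams d) (t n : ℕ) :
    P.real {ω | l1Norm (S t ω) = n} = ∑ x ∈ l1Sphere d n, ((stepLaw α) ^ t).coeff x := by
  rw [setOf_l1Norm_eq, ← sum_measureReal_preimage_singleton _
    fun y _ => hS.measurable t (measurableSet_singleton y)]
  exact Finset.sum_congr rfl fun x _ => hS.real_eq_coeff hα t x

lemma real_inter_l1Norm_succ (hS : IsSymmetricWalk P α S) (hα : α ∈ symmetricParams d) (t : ℕ)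
    (x : Fin d → ℤ) :
    P.real (S t ⁻¹' {x} ∩ {ω | l1Norm (S (t + 1) ω) = l1Norm x + 1}) =
      ((stepLaw α) ^ t).coeff x * upWeight α x := by
  rw [hS.real_eq_sum_inter_step hα t ((hS.measurable t (measurableSet_singleton x)).inter
    (hS.measurableSet_l1Norm_eq _ _)), upWeight, Finsupp.sum, Finset.mul_sum]
  refine Finset.sum_congr rfl fun a ha => ?_
  rw [← mul_assoc, ← hS.real_eq_coeff hα, ← hS.real_inter_step t _ (isUnitStep_of_mem_support ha)]
  split_ifs with h
  · rw [mul_one]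
    congr 1
    ext ω
    simp only [Set.mem_inter_iff, Set.mem_preimage, Set.mem_singleton_iff, Set.mem_ofPred_eq]
    constructor
    · rintro ⟨⟨h1, _⟩, h2⟩
      exact ⟨h1, h2⟩
    · rintro ⟨h1, h2⟩
      refine ⟨⟨h1, ?_⟩, h2⟩
      rw [← h, ← h1, ← h2, add_sub_cancel]
  · rw [mul_zero, ← measureReal_empty (μ := P)]
    congr 1
    refine Set.eq_empty_of_forall_notMem ?_
    rintro ω ⟨⟨h1, h2⟩, h3⟩
    simp only [Set.mem_preimage, Set.mem_singleton_iff, Set.mem_ofPred_eq] at h1 h2 h3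
    exact h (by rw [← h2, ← h1, ← h3, add_sub_cancel])

lemma real_l1Norm_eq_inter_succ (hS : IsSymmetricWalk P α S) (hα : α ∈ symmetricParams d)
    (t n : ℕ) :
    P.real ({ω | l1Norm (S t ω) = n} ∩ {ω | l1Norm (S (t + 1) ω) = n + 1}) =
      ∑ x ∈ l1Sphere d n, ((stepLaw α) ^ t).coeff x * upWeight α x := by
  have h : {ω | l1Norm (S t ω) = n} ∩ {ω | l1Norm (S (t + 1) ω) = n + 1} =
      ⋃ x ∈ l1Sphere d n, S t ⁻¹' {x} ∩ {ω | l1Norm (S (t + 1) ω) = l1Norm x + 1} := by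
    ext ω
    simp only [Set.mem_inter_iff, Set.mem_ofPred_eq, Set.mem_iUnion, Set.mem_preimage,
      Set.mem_singleton_iff, mem_l1Sphere, exists_prop]
    constructor
    · rintro ⟨h1, h2⟩
      exact ⟨S t ω, h1, rfl, by rw [h1, h2]⟩
    · rintro ⟨x, h1, rfl, h2⟩
      exact ⟨h1, by rw [h2, h1]⟩
  rw [h, measureReal_biUnion_finset]
  · exact Finset.sum_congr rfl fun x _ => hS.real_inter_l1Norm_succ hα t x
  · intro a _ b _ hab
    exact (Disjoint.preimage _ (Set.disjoint_singleton.2 hab)).mono Set.inter_subset_left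
      Set.inter_subset_left
  · exact fun x _ => (hS.measurable t (measurableSet_singleton x)).inter
      (hS.measurableSet_l1Norm_eq _ _)

/-- Almost surely, `t_j = j` for all `j`. -/
lemma ae_activeNorm_eq (hS : IsSymmetricWalk P α S) (hα : α ∈ symmetricParams d) :
    ∀ᵐ ω ∂P, ∀ j, activeNorm S j ω = l1Norm (S j ω) := by
  filter_upwards [ae_all_iff.2 (hS.ae_step_mem_support hα)] with ω hω j
  rw [activeNorm, activeTime_eq_self fun t => isUnitStep_of_mem_support (hω t)]

lemma setOf_activeNorm_ae_eq (hS : IsSymmetricWalk P α S) (hα : α ∈ symmetricParams d)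
    (j n : ℕ) : {ω | activeNorm S j ω = n} =ᵐ[P] {ω | l1Norm (S j ω) = n} := by
  filter_upwards [hS.ae_activeNorm_eq hα] with ω hω
  change (activeNorm S j ω = n) = (l1Norm (S j ω) = n)
  rw [hω]

lemma upProb_eq (hS : IsSymmetricWalk P α S) (hα : α ∈ symmetricParams d) (j n : ℕ) :
    upProb P S j n = (∑ x ∈ l1Sphere d n, ((stepLaw α) ^ j).coeff x * upWeight α x) /
      ∑ x ∈ l1Sphere d n, ((stepLaw α) ^ j).coeff x := by
  have h1 := hS.setOf_activeNorm_ae_eq hα j n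
  have h2 := hS.setOf_activeNorm_ae_eq hα (j + 1) (n + 1)
  -- `cond_apply` needs a measurable event, so the active norm is first replaced by the norm at time
  -- `j`, which agrees with it almost surely.
  have hcond : cond P {ω | activeNorm S j ω = n} = cond P {ω | l1Norm (S j ω) = n} := by
    rw [ProbabilityTheory.cond, ProbabilityTheory.cond, measure_congr h1,
      Measure.restrict_congr_set h1]
  rw [upProb, hcond, measureReal_congr (cond_absolutelyContinuous.ae_le h2), measureReal_def,
    cond_apply (hS.measurableSet_l1Norm_eq j n), ENNReal.toReal_mul, ENNReal.toReal_inv,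
    ← measureReal_def, ← measureReal_def, hS.real_l1Norm_eq hα,
    hS.real_l1Norm_eq_inter_succ hα, div_eq_inv_mul]

lemma mem_admissible_iff (hS : IsSymmetricWalk P α S) (hα : α ∈ symmetricParams d) {j n : ℕ} :
    j ∈ admissible P S n ↔ ∑ x ∈ l1Sphere d n, ((stepLaw α) ^ j).coeff x ≠ 0 := by
  rw [← hS.real_l1Norm_eq hα, admissible, Set.mem_ofPred_eq,
    measure_congr (hS.setOf_activeNorm_ae_eq hα j n), ne_eq, ne_eq, measureReal_eq_zero_iff]

end IsSymmetricWalk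

lemma atTop_inf_principal_mod_two_neBot (n : ℕ) :
    (atTop ⊓ 𝓟 {j : ℕ | j % 2 = n % 2}).NeBot := by
  rw [← frequently_mem_iff_neBot, frequently_atTop]
  exact fun a => ⟨2 * a + n, by omega, show (2 * a + n) % 2 = n % 2 by omega⟩

/-- Numerator and denominator of `upProb_eq` are both divided by the return probability at time
2⌊j/2⌋; along j ≡ n mod 2 all normalized weights tend to 1. -/
lemma IsSymmetricWalk.isLimitingUpProb {d : ℕ} {Ω : Type*} [MeasurableSpace Ω] {P : Measure Ω}
    [IsProbabilityMeasure P] {α : Fin (d + 1) → ℝ} {S : ℕ → Ω → Fin (d + 1) → ℤ}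
    (hS : IsSymmetricWalk P α S) (hα : α ∈ symmetricParams (d + 1)) (n : ℕ) :
    IsLimitingUpProb P S n
      ((∑ x ∈ l1Sphere (d + 1) n, upWeight α x) / (l1Sphere (d + 1) n).card) := by
  set F : Filter ℕ := atTop ⊓ 𝓟 {j : ℕ | j % 2 = n % 2} with hF
  have hpos : ∀ j, 0 < ((stepLaw α) ^ (2 * (j / 2))).coeff 0 := fun j =>
    (isSymmProb_stepLaw hα).coeff_pow_even_zero_pos _
  have hN : (0 : ℝ) < (l1Sphere (d + 1) n).card := by
    exact_mod_cast (l1Sphere_nonempty d n).card_pos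
  have hratio : ∀ x ∈ l1Sphere (d + 1) n,
      Tendsto (fun j => ((stepLaw α) ^ j).coeff x / ((stepLaw α) ^ (2 * (j / 2))).coeff 0)
        F (𝓝 1) := by
    intro x hx
    have h := tendsto_stepLaw_ratio hα x
    rwa [mem_l1Sphere.1 hx] at h
  have hden : Tendsto (fun j => (∑ x ∈ l1Sphere (d + 1) n, ((stepLaw α) ^ j).coeff x) /
      ((stepLaw α) ^ (2 * (j / 2))).coeff 0) F (𝓝 (l1Sphere (d + 1) n).card) := by
    simpa [Finset.sum_div] using tendsto_finsetSum _ hratio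
  have hnum : Tendsto (fun j =>
      (∑ x ∈ l1Sphere (d + 1) n, ((stepLaw α) ^ j).coeff x * upWeight α x) /
      ((stepLaw α) ^ (2 * (j / 2))).coeff 0) F (𝓝 (∑ x ∈ l1Sphere (d + 1) n, upWeight α x)) := by
    have h := tendsto_finsetSum _ fun x hx => (hratio x hx).mul_const (upWeight α x)
    simpa [Finset.sum_div, div_mul_eq_mul_div] using h
  have hup : Tendsto (fun j => upProb P S j n) F
      (𝓝 ((∑ x ∈ l1Sphere (d + 1) n, upWeight α x) / (l1Sphere (d + 1) n).card)) := by
    refine (hnum.div hden hN.ne').congr fun j => ?_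
    rw [hS.upProb_eq hα]
    exact div_div_div_cancel_right₀ (hpos j).ne' _ _
  have hadm : admissible P S n ⊆ {j : ℕ | j % 2 = n % 2} := by
    intro j hj
    obtain ⟨x, hx, hne⟩ := Finset.exists_ne_zero_of_sum_ne_zero ((hS.mem_admissible_iff hα).1 hj)
    rw [← mem_l1Sphere.1 hx]
    exact (l1Norm_of_stepLaw_pow_ne_zero hne).2
  refine ⟨?_, hup.mono_left (inf_le_inf_left _ (principal_mono.2 hadm))⟩
  -- The normalized denominator has a positive limit, so all large j of the right parity are
  -- admissible.
  have hev : ∀ᶠ j in F, j ∈ admissible P S n := by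
    filter_upwards [hden.eventually_const_lt hN] with j hj
    rw [hS.mem_admissible_iff hα]
    intro h0
    rw [h0, zero_div] at hj
    exact lt_irrefl _ hj
  have : F.NeBot := atTop_inf_principal_mod_two_neBot n
  exact Nat.frequently_atTop_iff_infinite.1 (hev.frequently.filter_mono inf_le_left)

end Walk

end

theorem theorem1 (d : ℕ) (hd : 2 ≤ d) (lam0 : ℝ) (hlam0 : 0 < lam0)
    {Ω : symmetricParams d → Type*} [∀ a, MeasurableSpace (Ω a)]
    (P : ∀ a, Measure (Ω a)) [∀ a, IsProbabilityMeasure (P a)]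
    (S : ∀ a, ℕ → Ω a → Fin d → ℤ)
    (hS : ∀ a : symmetricParams d, IsSymmetricWalk (P a) (a : Fin d → ℝ) (S a)) :
    IsConservative P S ∧
      ∀ (a : symmetricParams d) (n : ℕ),
        IsLimitingUpProb (P a) (S a) n
          (bdBirth lam0 2 d n / (bdBirth lam0 2 d n + bdDeath 2 d n)) := by
  obtain ⟨d, rfl⟩ : ∃ k, d = k + 1 := ⟨d - 1, by omega⟩
  have h : ∀ (a : symmetricParams (d + 1)) (n : ℕ), IsLimitingUpProb (P a) (S a) n
      (bdBirth lam0 2 (d + 1) n / (bdBirth lam0 2 (d + 1) n + bdDeath 2 (d + 1) n)) := by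
    intro a n
    rw [birth_probability_eq hlam0 a.2]
    exact (hS a).isLimitingUpProb a.2 n
  exact ⟨fun a₁ a₂ n => ⟨_, h a₁ n, h a₂ n⟩, h⟩
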